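/- Let $G$ be a finite group and $p$ a prime. Let $R\subset\mathbb{C}$ be the ring of all algebraic integers, $K$ its quotient field, $I$ a maximal ideal of $R$ containing $p$, and $F=R/I$. For an $F$-representation $X$ of $G$ the Brauer character of $X$ is the function on $G$ whose value at a $p$-regular element $g$ (an element of order prime to $p$) is the sum of the lifts of the eigenvalues of $X(g)$, with multiplicities, to $|G|_{p'}$-th roots of unity in $R$ along the reduction $R\to F$, and which is $0$ on $p$-singular elements. Let $\mathrm{Irr}(G)$ be the set of irreducible $K$-characters of $G$ and $\mathrm{IBr}(G)$ the set of irreducible Brauer characters, that is, those of irreducible $F$-representations. For $\chi\in\mathrm{Irr}(G)$ let $\hat\chi$ be the function which agrees with $\chi$ on $p$-regular elements and is $0$ on $p$-singular elements, and let $d_{\chi\varphi}\in\mathbb{Z}_{\ge 0}$ be the decomposition numbers, defined by $\hat\chi=\sum_{\varphi\in\mathrm{IBr}(G)}d_{\chi\varphi}\varphi$. For $\varphi\in\mathrm{IBr}(G)$ put $\Phi_\varphi=\sum_{\chi\in\mathrm{Irr}(G)}d_{\chi\varphi}\chi$. A projective character is a linear combination of the $\Phi_\varphi$ with non-negative integer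 coefficients. The $p$-blocks are the (sets of characters in) connected components of the graph on $\mathrm{Irr}(G)$ in which $\chi$ and $\psi$ are linked if $d_{\chi\varphi}\ne 0\ne d_{\psi\varphi}$ for some $\varphi\in\mathrm{IBr}(G)$. Let $B$ be a union of $p$-blocks of $G$. Let $\mathrm{IBr}(B)$ be the set of those $\varphi\in\mathrm{IBr}(G)$ with $d_{\chi\varphi}\neq0$ for some $\chi$ in $B$, and put $\mathrm{IPr}(B)=\{\Phi_\varphi:\varphi\in\mathrm{IBr}(B)\}$. A Brauer (projective) character of $B$ is a Brauer (projective) character of $G$ lying in the $\mathbb{Z}$-span $\mathbb{Z}\,\mathrm{IBr}(B)$ (respectively $\mathbb{Z}\,\mathrm{IPr}(B)$). A basic set of Brauer (projective) characters of $B$ is a $\mathbb{Z}$-basis of $\mathbb{Z}\,\mathrm{IBr}(B)$ (respectively $\mathbb{Z}\,\mathrm{IPr}(B)$) consisting of Brauer (projective) characters of $B$. Let $\mathbf{BS}$ be a set of Brauer characters of $B$ and $\mathbf{PS}$ a set of projective characters of $B$, each with exactly $|\mathrm{IBr}(B)|$ elements and each listed in some order, and let $U=\langle\mathbf{BS},\mathbf{PS}\rangle$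 be the square matrix of mutual inner products, where $\langle\lambda,\mu\rangle=\frac1{|G|}\sum_{g\in G}\lambda(g)\overline{\mu(g)}$. Then $U$ has integer entries, and $\mathbf{BS}$ and $\mathbf{PS}$ are both basic sets if and only if $U$ is invertible over $\mathbb{Z}$. -/

import Mathlib

noncomputable section

namespace ModularCharacters

/-- The ring `R` of all algebraic integers (inside `ℂ`). -/
abbrev AlgInt : Type := integralClosure ℤ ℂ

/-- The field `K` of all algebraic numbers (inside `ℂ`), the quotient field of `R`. -/
abbrev AlgNum : Type := algebraicClosure ℚ ℂ

/-- The field structure on `F = R/I` for a maximal ideal `I` of `R`. -/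
instance residueField (I : Ideal AlgInt) [I.IsMaximal] : Field (AlgInt ⧸ I) :=
  Ideal.Quotient.field I

section Definitions

variable {G : Type*} [Group G] [Fintype G]

/-- An element of `G` is `p`-regular if its order is not divisible by `p`. -/
def IsPRegular (p : ℕ) (g : G) : Prop := ¬ p ∣ orderOf g

/-- The inner product `⟨λ, μ⟩ = |G|⁻¹ ∑_g λ(g) conj (μ(g))` of complex-valued functions on `G`. -/
def charInner (lam mu : G → ℂ) : ℂ :=
  (Nat.card G : ℂ)⁻¹ * ∑ g : G, lam g * (starRingEnd ℂ) (mu g)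

variable (G) in
/-- `Irr(G)`: the set of characters of the irreducible `K`-representations of `G`. -/
def Irr : Set (G → ℂ) :=
  {χ | ∃ (n : ℕ) (X : Representation AlgNum G (Fin n → AlgNum)),
    X.IsIrreducible ∧ ∀ g, χ g = (X.character g : ℂ)}

open Classical in
/-- The restriction of a function on `G` to the `p`-regular elements,
extended by `0` to the `p`-singular elements. -/
def pRegularRestriction (p : ℕ) (χ : G → ℂ) : G → ℂ :=
  fun g => if IsPRegular p g then χ g else 0

variable (p : ℕ) (I : Ideal AlgInt) [I.IsMaximal]

variable (G) in
/-- The inverse of the isomorphism from the group of `|G|_{p'}`-th roots of unity in `R`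
onto that of `F = R/I` induced by reduction modulo `I`: `rootLift G p I ζ` is the unique
`|G|_{p'}`-th root of unity of `R` which reduces to `ζ`. -/
def rootLift (ζ : AlgInt ⧸ I) : AlgInt :=
  Classical.epsilon fun z : AlgInt =>
    z ^ (ordCompl[p] (Nat.card G)) = 1 ∧ Ideal.Quotient.mk I z = ζ

open Classical in
/-- The Brauer character of an `F`-representation `X` of `G`: on a `p`-regular element `g` it is
the sum of the lifts of the eigenvalues of `X g` (with multiplicities),
and it is `0` on `p`-singular elements. -/
def brauerCharacter {n : ℕ} (X : Representation (AlgInt ⧸ I) G (Fin n → AlgInt ⧸ I)) : G → ℂ :=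
  fun g => if IsPRegular p g then
    ((X g).charpoly.roots.map fun ζ => (rootLift G p I ζ : ℂ)).sum else 0

variable (G) in
/-- The set of all Brauer characters of `G`. -/
def BrauerCharacters : Set (G → ℂ) :=
  {θ | ∃ (n : ℕ) (X : Representation (AlgInt ⧸ I) G (Fin n → AlgInt ⧸ I)),
    θ = brauerCharacter p I X}

variable (G) in
/-- `IBr(G)`: the set of irreducible Brauer characters of `G`. -/
def IBr : Set (G → ℂ) :=
  {φ | ∃ (n : ℕ) (X : Representation (AlgInt ⧸ I) G (Fin n → AlgInt ⧸ I)),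
    X.IsIrreducible ∧ φ = brauerCharacter p I X}

/-- The row `(d_{χφ})_φ` of the decomposition matrix: the non-negative integers determined by
`χ̂ = ∑_{φ ∈ IBr(G)} d_{χφ} φ`. -/
def decompositionRow (χ : G → ℂ) : IBr G p I →₀ ℕ :=
  Classical.epsilon fun d : IBr G p I →₀ ℕ =>
    pRegularRestriction p χ = d.sum fun φ m => m • (φ : G → ℂ)

/-- The decomposition number `d_{χφ}`. -/
def decompositionNumber (χ : Irr G) (φ : IBr G p I) : ℕ :=
  decompositionRow p I (χ : G → ℂ) φ

/-- The projective indecomposable character `Φ_φ = ∑_{χ ∈ Irr(G)} d_{χφ} χ`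
(a finite sum, as `Irr(G)` is finite). -/
def pim (φ : IBr G p I) : G → ℂ :=
  ∑ᶠ χ : Irr G, decompositionNumber p I χ φ • (χ : G → ℂ)

variable (G) in
/-- `IPr(G)`: the set of all projective indecomposable characters. -/
def IPr : Set (G → ℂ) := Set.range (pim (G := G) p I)

variable (G) in
/-- The projective characters of `G`: the linear combinations of projective indecomposable
characters with non-negative integer coefficients. -/
def ProjectiveCharacters : Set (G → ℂ) := AddSubmonoid.closure (IPr G p I)

variable (G) in
/-- The Brauer graph: its vertex set is `Irr(G)`, and two (distinct) vertices `χ`, `ψ` are linked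
if `d_{χφ} ≠ 0 ≠ d_{ψφ}` for some `φ ∈ IBr(G)`. -/
def brauerGraph : SimpleGraph (Irr G) where
  Adj χ ψ := χ ≠ ψ ∧ ∃ φ : IBr G p I,
    decompositionNumber p I χ φ ≠ 0 ∧ decompositionNumber p I ψ φ ≠ 0
  symm := ⟨fun _ _ h => ⟨h.1.symm, h.2.imp fun _ hφ => ⟨hφ.2, hφ.1⟩⟩⟩
  loopless := ⟨fun _ h => h.1 rfl⟩

/-- A `p`-block of `G`: the set of characters in a connected component of the Brauer graph. -/
def IsBlock (b : Set (Irr G)) : Prop :=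
  ∃ c : (brauerGraph G p I).ConnectedComponent, b = c.supp

/-- `B` (given by the set `Irr(B)`) is a union of `p`-blocks of `G`. -/
def IsUnionOfBlocks (B : Set (Irr G)) : Prop :=
  ∃ S : Set (Set (Irr G)), (∀ b ∈ S, IsBlock p I b) ∧ B = ⋃₀ S

variable (B : Set (Irr G))

/-- The irreducible Brauer characters `φ` which lie in `B`, i.e. `d_{χφ} ≠ 0` for some
`χ ∈ Irr(B)`. -/
def InBlocks (φ : IBr G p I) : Prop := ∃ χ ∈ B, decompositionNumber p I χ φ ≠ 0

/-- `IBr(B)`: the set of irreducible Brauer characters in `B`. -/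
def IBrOf : Set (G → ℂ) := {θ | ∃ φ : IBr G p I, InBlocks p I B φ ∧ θ = φ}

/-- `IPr(B)`: the set of projective indecomposable characters in `B`. As the ordinary constituents
of `Φ_φ` are the `χ` with `d_{χφ} ≠ 0`, these are the `Φ_φ` with `φ ∈ IBr(B)`. -/
def IPrOf : Set (G → ℂ) := {Φ | ∃ φ : IBr G p I, InBlocks p I B φ ∧ Φ = pim p I φ}

/-- The group of generalized Brauer characters of `B`: the `ℤ`-span of `IBr(B)`. -/
def brauerGroupOf : Submodule ℤ (G → ℂ) := Submodule.span ℤ (IBrOf p I B)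

/-- The group `K₀(B)` of generalized projective characters of `B`: the `ℤ`-span of `IPr(B)`. -/
def projectiveGroupOf : Submodule ℤ (G → ℂ) := Submodule.span ℤ (IPrOf p I B)

/-- The (genuine) Brauer characters of `B`. -/
def BrauerCharactersOf : Set (G → ℂ) := BrauerCharacters G p I ∩ brauerGroupOf p I B

/-- The (genuine) projective characters of `B`. -/
def ProjectiveCharactersOf : Set (G → ℂ) := ProjectiveCharacters G p I ∩ projectiveGroupOf p I B

/-- `S` is a `ℤ`-basis of the group `M` of functions. -/
def IsZBasis (M : Submodule ℤ (G → ℂ)) (S : Set (G → ℂ)) : Prop :=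
  LinearIndependent ℤ (Subtype.val : S → G → ℂ) ∧ Submodule.span ℤ S = M

/-- A basic set of Brauer characters of `B`: a `ℤ`-basis of the group of generalized Brauer
characters of `B` which consists of Brauer characters. -/
def IsBasicSetOfBrauerCharacters (S : Set (G → ℂ)) : Prop :=
  S ⊆ BrauerCharactersOf p I B ∧ IsZBasis (brauerGroupOf p I B) S

/-- A basic set of projective characters of `B`: a `ℤ`-basis of `K₀(B)` which consists of
projective characters. -/
def IsBasicSetOfProjectiveCharacters (S : Set (G → ℂ)) : Prop :=
  S ⊆ ProjectiveCharactersOf p I B ∧ IsZBasis (projectiveGroupOf p I B) S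

end Definitions

/-- The matrix `⟨M, N⟩` of mutual inner products of two sets of functions on `G`, each listed in
a particular order. -/
def innerMatrix {G : Type*} [Group G] [Fintype G] {m n : ℕ} {M N : Set (G → ℂ)}
    (e : Fin m ≃ M) (f : Fin n ≃ N) : Matrix (Fin m) (Fin n) ℂ :=
  Matrix.of fun i j => charInner (e i : G → ℂ) (f j : G → ℂ)

end ModularCharacters

end

/-! The theorem rests on the duality ⟨ψ, Φ_φ⟩ = δ_{ψφ} between `IBr` and the projective
indecomposable characters. Given it, write `BS` = A · IBr(B) and `PS` = P · IPr(B) with integer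
matrices A and P. Then U = A Pᵀ, so det U = det A · det P, a unit exactly when both factors are
units, and A (or P) is invertible over ℤ exactly when its set is a ℤ-basis.

Duality (`charInner_ibr_pim`): a Brauer character ψ is a class function, so ψ = ∑ ⟨ψ, χ⟩ χ by
completeness of `Irr G`. Restricting to p-regular elements gives ψ = ∑ ⟨ψ, χ⟩ χ̂ = ∑ ⟨ψ, Φ_φ⟩ φ, and
coefficients may be compared once `IBr` is linearly independent and every χ̂ is an ℕ-combination of
`IBr`.

Both inputs come from a valuation ring V of K above I with residue field F
(`exists_valuationSubring`). For independence, a relation is scaled into V with one coefficient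
equal to 1 and reduced to a relation between irreducible F-characters, which are independent by
Jacobson density. For decomposition, a K-representation has a V-form, whose reduction has Brauer
character χ̂; Brauer characters are additive along subrepresentations. -/

noncomputable section

namespace ModularCharacters

/-! ### Transport between abstract spaces, coordinates and modules -/

section RepresentationTransport

open Representation

variable {k G V W : Type*} [Field k] [Group G] [AddCommGroup V] [Module k V]
  [AddCommGroup W] [Module k W]

/-- The representation obtained by transport of structure along a linear equivalence. -/
def transport (ρ : Representation k G V) (e : V ≃ₗ[k] W) : Representation k G W where
  toFun g := e.conj (ρ g)
  map_one' := by ext; simp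
  map_mul' g h := by ext; simp [LinearEquiv.conj_apply]

/-- Transport of structure yields an equivalent representation. -/
def transportEquiv (ρ : Representation k G V) (e : V ≃ₗ[k] W) : ρ.Equiv (transport ρ e) :=
  .mk e fun g => by ext; simp [transport, LinearEquiv.conj_apply]

theorem exists_equiv_fin [FiniteDimensional k V] (ρ : Representation k G V) :
    ∃ Y : Representation k G (Fin (Module.finrank k V) → k), Nonempty (ρ.Equiv Y) :=
  ⟨_, ⟨transportEquiv ρ (Module.finBasis k V).equivFun⟩⟩

theorem isIrreducible_of_equiv {ρ : Representation k G V} {σ : Representation k G W}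
    (e : ρ.Equiv σ) (h : ρ.IsIrreducible) : σ.IsIrreducible := by
  rw [irreducible_iff_isSimpleModule_asModule] at h ⊢
  exact IsSimpleModule.congr (LinearEquiv.ofBijective
    (IntertwiningMap.equivLinearMapAsModule σ ρ e.symm.toIntertwiningMap) e.symm.bijective)

theorem isIrreducible_ofModule' [Module (MonoidAlgebra k G) V]
    [IsScalarTower k (MonoidAlgebra k G) V]
    [IsSimpleModule (MonoidAlgebra k G) V] : (ofModule' (k := k) (G := G) V).IsIrreducible := by
  rw [irreducible_iff_isSimpleModule_asModule]
  let e : (ofModule' (k := k) (G := G) V).asModule ≃ₗ[k] V := asModuleEquiv _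
  exact IsSimpleModule.congr (LinearEquiv.ofBijective
    (MonoidAlgebra.equivariantOfLinearOfComm e.toLinearMap fun g v => by
      change e _ = _
      rw [single_smul]
      simp only [e, ofModule', MonoidAlgebra.lift_symm_apply, one_smul]
      rfl) e.bijective)

end RepresentationTransport

/-! ### Completeness of irreducible characters in characteristic zero -/

section ClassFunctions

open Representation

variable {k G V : Type*} [Field k] [Group G] [Fintype G] [AddCommGroup V] [Module k V]

/-- Since θ is a class function, the operator commutes with `ρ`, so by Schur it is a scalar. Its
trace vanishes by `h0`, and dim V ≠ 0 in k. -/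
theorem sum_smul_inv_eq_zero [IsAlgClosed k] [CharZero k] [FiniteDimensional k V]
    (ρ : Representation k G V) [ρ.IsIrreducible] (θ : G → k)
    (hθ : ∀ g h, θ (h * g * h⁻¹) = θ g) (h0 : ∑ g, θ g * ρ.character g⁻¹ = 0) :
    ∑ g, θ g • ρ g⁻¹ = 0 := by
  set T : Module.End k V := ∑ g, θ g • ρ g⁻¹ with hT
  have hcomm : ∀ h, T * ρ h = ρ h * T := by
    intro h
    rw [hT, Finset.sum_mul, Finset.mul_sum]
    refine Fintype.sum_equiv (MulAut.conj h⁻¹).toEquiv _ _ fun g => ?_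
    have : θ ((MulAut.conj h⁻¹) g) = θ g := by simpa using hθ g h⁻¹
    simp only [MulEquiv.toEquiv_eq_coe, EquivLike.coe_coe, this, smul_mul_assoc, mul_smul_comm,
      ← map_mul]
    congr 2
    simp [mul_assoc]
  let f : IntertwiningMap ρ ρ := ⟨T, fun g => hcomm g⟩
  obtain ⟨c, hc⟩ := (IsIrreducible.algebraMap_intertwiningMap_bijective_of_isAlgClosed
    (ρ := ρ)).2 f
  have hTc : T = c • (1 : Module.End k V) := by
    have := congrArg IntertwiningMap.toLinearMap hc
    exact this.symm
  have htr : LinearMap.trace k V T = ∑ g, θ g * ρ.character g⁻¹ := by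
    simp [hT, character, map_sum]
  rw [h0, hTc] at htr
  have hne : Nontrivial V := by
    have := IsSimpleModule.nontrivial (MonoidAlgebra k G) ρ.asModule
    exact this
  have : c = 0 := by
    simpa [Module.finrank_pos.ne'] using htr
  rw [hTc, this, zero_smul]

theorem sum_single_inv_smul_eq_zero [IsAlgClosed k] [CharZero k] (θ : G → k)
    (hθ : ∀ g h, θ (h * g * h⁻¹) = θ g)
    (h0 : ∀ (n : ℕ) (X : Representation k G (Fin n → k)), X.IsIrreducible →
      ∑ g, θ g * X.character g⁻¹ = 0)
    (M : Type*) [AddCommGroup M] [Module k M] [Module (MonoidAlgebra k G) M]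
    [IsScalarTower k (MonoidAlgebra k G) M]
    [IsSimpleModule (MonoidAlgebra k G) M] (v : M) :
    (∑ g, MonoidAlgebra.single g⁻¹ (θ g) : MonoidAlgebra k G) • v = 0 := by
  have hirr := isIrreducible_ofModule' (k := k) (G := G) (V := M)
  have hfin : FiniteDimensional k M := Module.Finite.trans (MonoidAlgebra k G) _
  obtain ⟨Y, ⟨e⟩⟩ := exists_equiv_fin (ofModule' (k := k) (G := G) M)
  have h1 := sum_smul_inv_eq_zero (ofModule' (k := k) (G := G) M) θ hθ (by
    rw [char_iso e]
    exact h0 _ Y (isIrreducible_of_equiv e hirr))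
  have h2 := LinearMap.congr_fun h1 v
  rw [Finset.sum_smul]
  simp only [ofModule', LinearMap.sum_apply, LinearMap.smul_apply, MonoidAlgebra.lift_symm_apply,
    Algebra.lsmul_coe, LinearMap.zero_apply, ← smul_assoc, MonoidAlgebra.smul_single,
    smul_eq_mul, mul_one] at h2
  exact h2

/-- The element ∑ θ(g) g⁻¹ kills every simple submodule of the group algebra, hence by Maschke the
whole algebra, and in particular 1. -/
theorem classFunction_eq_zero [IsAlgClosed k] [CharZero k] (θ : G → k)
    (hθ : ∀ g h, θ (h * g * h⁻¹) = θ g)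
    (h0 : ∀ (n : ℕ) (X : Representation k G (Fin n → k)), X.IsIrreducible →
      ∑ g, θ g * X.character g⁻¹ = 0) : θ = 0 := by
  have hcard : NeZero (Nat.card G : k) := ⟨by exact_mod_cast Nat.card_pos.ne'⟩
  let z : MonoidAlgebra k G := ∑ g, MonoidAlgebra.single g⁻¹ (θ g)
  have key : ∀ v : MonoidAlgebra k G, z * v = 0 := by
    intro v
    have hv : v ∈ ⨆ N : {N : Submodule (MonoidAlgebra k G) (MonoidAlgebra k G) //
        IsSimpleModule (MonoidAlgebra k G) N}, N.1 := by
      have := IsSemisimpleModule.sSup_simples_eq_top (MonoidAlgebra k G) (MonoidAlgebra k G)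
      rw [sSup_eq_iSup'] at this
      exact this ▸ Submodule.mem_top
    induction hv using Submodule.iSup_induction' with
    | mem N v hv =>
      have := N.2
      exact congrArg Subtype.val (sum_single_inv_smul_eq_zero θ hθ h0 N.1 ⟨v, hv⟩)
    | zero => simp
    | add x y _ _ hx hy => rw [mul_add, hx, hy, add_zero]
  have hz : z = 0 := by simpa using key 1
  funext g
  have := congrArg (fun a : MonoidAlgebra k G => a.coeff g⁻¹) hz
  classical
  simpa [z, MonoidAlgebra.coeff_sum, Finsupp.single_apply] using this

end ClassFunctions

/-! ### Traces of powers of an operator of finite order -/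

section Eigenvalues

variable {k V : Type*} [Field k] [IsAlgClosed k] [CharZero k] [AddCommGroup V] [Module k V]
  [FiniteDimensional k V]

/-- The traces of the powers of an endomorphism of finite order, in terms of the multiplicities of
its eigenvalues. -/
theorem exists_trace_pow_eq_sum (f : Module.End k V) {n : ℕ} (hn : n ≠ 0) (hf : f ^ n = 1) :
    ∃ (S : Finset k) (m : k → ℕ), (∀ μ ∈ S, μ ^ n = 1) ∧
      ∀ j, LinearMap.trace k V (f ^ j) = ∑ μ ∈ S, m μ * μ ^ j := by
  classical
  have hss : f.IsSemisimple := Module.End.isSemisimple_of_squarefree_aeval_eq_zero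
    (p := Polynomial.X ^ n - 1)
    (Polynomial.X_pow_sub_one_separable_iff.2 (by exact_mod_cast hn)).squarefree (by simp [hf])
  have hint := DirectSum.isInternal_submodule_of_iSupIndep_of_iSup_eq_top
    f.eigenspaces_iSupIndep hss.iSup_eigenspace_eq_top
  have hfin : {μ | f.eigenspace μ ≠ ⊥}.Finite :=
    WellFoundedGT.finite_ne_bot_of_iSupIndep f.eigenspaces_iSupIndep
  have hpow : ∀ j μ, ∀ x ∈ f.eigenspace μ, (f ^ j) x = μ ^ j • x := by
    intro j μ x hx
    induction j with
    | zero => simp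
    | succ j ih =>
      rw [pow_succ, Module.End.mul_apply, Module.End.mem_eigenspace_iff.mp hx, map_smul, ih,
        smul_smul, pow_succ, mul_comm]
  refine ⟨hfin.toFinset, fun μ => Module.finrank k (f.eigenspace μ), fun μ hμ => ?_, fun j => ?_⟩
  · obtain ⟨x, hx, hx0⟩ := (Submodule.ne_bot_iff _).1 (hfin.mem_toFinset.1 hμ)
    have := hpow n μ x hx
    rw [hf, Module.End.one_apply] at this
    have h : (μ ^ n - 1) • x = 0 := by rw [sub_smul, ← this, one_smul, sub_self]
    exact sub_eq_zero.1 ((smul_eq_zero.1 h).resolve_right hx0)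
  · have hmaps : ∀ μ, Set.MapsTo (f ^ j) (f.eigenspace μ) (f.eigenspace μ) := fun μ x hx => by
      rw [SetLike.mem_coe, hpow j μ x hx]
      exact Submodule.smul_mem _ _ hx
    rw [LinearMap.trace_eq_sum_trace_restrict' hint hfin hmaps]
    refine Finset.sum_congr rfl fun μ _ => ?_
    have : (f ^ j).restrict (hmaps μ) = μ ^ j • (1 : Module.End k (f.eigenspace μ)) := by
      ext x
      exact hpow j μ x x.2
    rw [this, map_smul, LinearMap.trace_one, smul_eq_mul, mul_comm]

end Eigenvalues

/-! ### Sesquilinearity of the inner product -/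

section InnerProduct

variable {G : Type*} [Fintype G]

theorem charInner_add_left (a b c : G → ℂ) :
    charInner (a + b) c = charInner a c + charInner b c := by
  simp [charInner, add_mul, Finset.sum_add_distrib, mul_add]

theorem charInner_smul_left (z : ℂ) (a c : G → ℂ) :
    charInner (z • a) c = z * charInner a c := by
  simp only [charInner, Pi.smul_apply, smul_eq_mul, Finset.mul_sum]
  exact Finset.sum_congr rfl fun g _ => by ring

theorem charInner_sum_left {ι : Type*} (s : Finset ι) (a : ι → G → ℂ) (c : G → ℂ) :
    charInner (∑ i ∈ s, a i) c = ∑ i ∈ s, charInner (a i) c := by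
  simp only [charInner, Finset.sum_apply, Finset.sum_mul, Finset.mul_sum]
  exact Finset.sum_comm

theorem charInner_sum_right {ι : Type*} (s : Finset ι) (c : G → ℂ) (a : ι → G → ℂ) :
    charInner c (∑ i ∈ s, a i) = ∑ i ∈ s, charInner c (a i) := by
  simp only [charInner, Finset.sum_apply, map_sum, Finset.mul_sum]
  exact Finset.sum_comm

theorem charInner_smul_right (z : ℂ) (a c : G → ℂ) :
    charInner c (z • a) = (starRingEnd ℂ) z * charInner c a := by
  simp only [charInner, Pi.smul_apply, smul_eq_mul, Finset.mul_sum, map_mul]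
  exact Finset.sum_congr rfl fun g _ => by ring

end InnerProduct

/-! ### `Irr G` as an orthonormal basis of the class functions -/

section OrdinaryCharacters

open Representation

variable {G : Type*} [Group G] [Fintype G]

instance isAlgClosed_algNum : IsAlgClosed AlgNum :=
  (algebraicClosure.isAlgClosure ℚ ℂ).isAlgClosed

/-- The eigenvalues are roots of unity, which conjugation inverts; with n the order of g, both
inversions are written as the (n - 1)-st power. -/
theorem conj_character {V : Type*} [AddCommGroup V] [Module AlgNum V] [FiniteDimensional AlgNum V]
    (X : Representation AlgNum G V) (g : G) :
    (starRingEnd ℂ) (X.character g : ℂ) = (X.character g⁻¹ : ℂ) := by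
  have hpos := (orderOf_pos g).ne'
  obtain ⟨S, m, hS, htr⟩ := exists_trace_pow_eq_sum (X g) hpos
    (by rw [← map_pow, pow_orderOf_eq_one, map_one])
  have h1 : X.character g = ∑ μ ∈ S, m μ * μ ^ 1 := by
    rw [← htr, pow_one, character]
  have h2 : X.character g⁻¹ = ∑ μ ∈ S, m μ * μ ^ (orderOf g - 1) := by
    rw [← htr, ← map_pow, character]
    congr 2
    rw [inv_eq_iff_mul_eq_one, mul_pow_sub_one hpos, pow_orderOf_eq_one]
  rw [h1, h2]
  push_cast
  rw [map_sum]
  refine Finset.sum_congr rfl fun μ hμ => ?_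
  have hμ1 : (μ : ℂ) ^ orderOf g = 1 := by
    exact_mod_cast congrArg (Subtype.val : AlgNum → ℂ) (hS μ hμ)
  rw [map_mul, pow_one, ← Complex.inv_eq_conj (Complex.norm_eq_one_of_pow_eq_one hμ1 hpos)]
  congr 1
  · simp
  · exact inv_eq_of_mul_eq_one_right (by rw [mul_pow_sub_one hpos, hμ1])

theorem charInner_characters {m n : ℕ} (X : Representation AlgNum G (Fin m → AlgNum))
    (Y : Representation AlgNum G (Fin n → AlgNum)) :
    charInner (fun g => (X.character g : ℂ)) (fun g => (Y.character g : ℂ)) =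
      (((Nat.card G : AlgNum)⁻¹ * ∑ g, X.character g * Y.character g⁻¹ : AlgNum) : ℂ) := by
  simp only [charInner, conj_character]
  push_cast
  rfl

open Classical in
theorem charInner_irr (χ ψ : Irr G) :
    charInner (χ : G → ℂ) (ψ : G → ℂ) = if χ = ψ then 1 else 0 := by
  have hinv : Invertible (Nat.card G : AlgNum) :=
    invertibleOfNonzero (by exact_mod_cast Nat.card_pos.ne')
  obtain ⟨χ, m, X, hX, hχ⟩ := χ
  obtain ⟨ψ, n, Y, hY, hψ⟩ := ψ
  obtain rfl : χ = fun g => (X.character g : ℂ) := funext hχ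
  split_ifs with h
  · rw [← h]
    change charInner (fun g => (X.character g : ℂ)) (fun g => (X.character g : ℂ)) = 1
    rw [charInner_characters, char_orthonormal, if_pos ⟨.refl X⟩]
    simp
  · obtain rfl : ψ = fun g => (Y.character g : ℂ) := funext hψ
    change charInner (fun g => (X.character g : ℂ)) (fun g => (Y.character g : ℂ)) = 0
    rw [charInner_characters, char_orthonormal, if_neg]
    · simp
    · rintro ⟨e⟩
      exact h (by simp [char_iso e])

instance finite_irr : Finite (Irr G) := by
  classical
  have hli : LinearIndependent ℂ (Subtype.val : Irr G → G → ℂ) := by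
    refine linearIndependent_iff'.2 fun s c hc χ hχ => ?_
    have := congrArg (fun a => charInner a (χ : G → ℂ)) hc
    simp only [charInner_sum_left, charInner_smul_left, charInner_irr] at this
    simpa [hχ, charInner] using this
  exact hli.finite

theorem classFunction_eq_sum_irr [Fintype (Irr G)] (θ : G → ℂ)
    (hθ : ∀ g h, θ (h * g * h⁻¹) = θ g) :
    θ = ∑ χ : Irr G, charInner θ (χ : G → ℂ) • (χ : G → ℂ) := by
  classical
  rw [← sub_eq_zero]
  set η := θ - ∑ χ : Irr G, charInner θ (χ : G → ℂ) • (χ : G → ℂ) with hη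
  have hclass : ∀ g h, η (h * g * h⁻¹) = η g := by
    intro g h
    simp only [hη, Pi.sub_apply, hθ, Finset.sum_apply, Pi.smul_apply]
    congr 1
    refine Finset.sum_congr rfl fun χ _ => ?_
    obtain ⟨χ, m, X, hX, hχ⟩ := χ
    simp [hχ]
  have hort : ∀ χ : Irr G, charInner η (χ : G → ℂ) = 0 := by
    intro χ
    rw [hη, sub_eq_add_neg, charInner_add_left, ← neg_one_smul ℂ, charInner_smul_left,
      charInner_sum_left]
    simp [charInner_smul_left, charInner_irr]
  funext g
  -- η has complex values, but completeness was proved over K. Every K-linear functional ℂ → K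
  -- preserves orthogonality to the K-valued characters, and such functionals separate points.
  rw [Pi.zero_apply, ← Module.forall_dual_apply_eq_zero_iff AlgNum]
  intro l
  refine congrFun (classFunction_eq_zero (k := AlgNum) (fun g => l (η g))
    (fun g h => by rw [hclass]) fun n X hX => ?_) g
  have h1 := hort ⟨fun g => (X.character g : ℂ), n, X, hX, fun _ => rfl⟩
  simp only [charInner, conj_character, mul_eq_zero, inv_eq_zero, Nat.cast_eq_zero,
    Nat.card_pos.ne', false_or] at h1
  have h2 := congrArg l h1
  rw [map_sum, map_zero] at h2
  rw [← h2]
  refine Finset.sum_congr rfl fun g _ => ?_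
  have : η g * (X.character g⁻¹ : ℂ) = X.character g⁻¹ • η g := by
    rw [mul_comm]; rfl
  rw [this, map_smul, smul_eq_mul, mul_comm]

end OrdinaryCharacters

/-! ### Independence of irreducible characters in any characteristic -/

section TraceIndependence

open Representation

theorem exists_end_trace_eq_one (k V : Type*) [Field k] [AddCommGroup V] [Module k V]
    [FiniteDimensional k V] [Nontrivial V] : ∃ T : Module.End k V, LinearMap.trace k V T = 1 := by
  obtain ⟨v, hv⟩ := exists_ne (0 : V)
  obtain ⟨φ, hφ⟩ : ∃ φ : Module.Dual k V, φ v ≠ 0 := by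
    by_contra! h
    exact hv ((Module.forall_dual_apply_eq_zero_iff k v).1 h)
  exact ⟨(φ v)⁻¹ • φ.smulRight v, by simp [LinearMap.trace_smulRight, hφ]⟩

section Density

variable {k A ι : Type*} [Field k] [IsAlgClosed k] [Ring A] [Algebra k A] [Finite ι]
  {M : ι → Type*} [∀ i, AddCommGroup (M i)] [∀ i, Module k (M i)] [∀ i, FiniteDimensional k (M i)]
  [∀ i, Module A (M i)] [∀ i, IsScalarTower k A (M i)] [∀ i, IsSimpleModule A (M i)]

theorem exists_end_pi_apply_eq_smul (hne : ∀ i j, i ≠ j → IsEmpty (M i ≃ₗ[A] M j))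
    (φ : Module.End A (∀ i, M i)) (i : ι) : ∃ c : k, ∀ x, φ x i = c • x i := by
  classical
  have := Fintype.ofFinite ι
  let ψ : ∀ l, M l →ₗ[A] M i := fun l => LinearMap.proj i ∘ₗ φ ∘ₗ LinearMap.single A M l
  have hψ : ∀ l, l ≠ i → ψ l = 0 := fun l hl =>
    (LinearMap.bijective_or_eq_zero (ψ l)).resolve_left fun h =>
      (hne l i hl).false (LinearEquiv.ofBijective _ h)
  obtain ⟨c, hc⟩ := (IsSimpleModule.algebraMap_end_bijective_of_isAlgClosed
    (A := A) (V := M i) k).2 (ψ i)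
  refine ⟨c, fun x => ?_⟩
  have hx : φ x i = ∑ l, ψ l (x l) := by
    conv_lhs => rw [← Finset.univ_sum_single x, map_sum]
    simp [ψ]
  rw [hx, Finset.sum_eq_single i (fun l _ hl => by rw [hψ l hl]; rfl) (by simp), ← hc]
  rfl

/-- By Schur, endomorphisms of the product are diagonal scalars, so the map equal to T on the j-th
factor and 0 elsewhere commutes with them. Jacobson density realises it by a ring element on a
finite basis. -/
theorem exists_smul_eq_end (hne : ∀ i j, i ≠ j → IsEmpty (M i ≃ₗ[A] M j))
    (j : ι) (T : Module.End k (M j)) :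
    ∃ r : A, (∀ v : M j, r • v = T v) ∧ ∀ i, i ≠ j → ∀ v : M i, r • v = 0 := by
  classical
  have := Fintype.ofFinite ι
  let f : Module.End (Module.End A (∀ i, M i)) (∀ i, M i) :=
    { toFun := fun m => Pi.single j (T (m j))
      map_add' := fun x y => by rw [← Pi.single_add, Pi.add_apply, map_add]
      map_smul' := fun φ x => by
        obtain ⟨c, hc⟩ := exists_end_pi_apply_eq_smul (k := k) hne φ j
        funext i
        obtain ⟨d, hd⟩ := exists_end_pi_apply_eq_smul (k := k) hne φ i
        by_cases hij : i = j
        · subst hij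
          simp only [RingHom.id_apply, Module.End.smul_def, Pi.single_eq_same]
          rw [hc, hc, map_smul, Pi.single_eq_same]
        · simp [hd, Pi.single_eq_of_ne hij] }
  let b := fun i => Module.finBasis k (M i)
  obtain ⟨r, hr⟩ := jacobson_density f
    (Finset.univ.image fun a : Σ i, Fin (Module.finrank k (M i)) =>
      (Pi.single a.1 (b a.1 a.2) : ∀ i, M i))
  have hr' : ∀ i a, f (Pi.single i (b i a)) i = r • b i a := fun i a => by
    rw [hr _ (Finset.mem_image.2 ⟨⟨i, a⟩, Finset.mem_univ _, rfl⟩)]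
    simp
  have hlin : ∀ i (S : Module.End k (M i)), (∀ a, r • b i a = S (b i a)) →
      ∀ v : M i, r • v = S v := fun i S h v => by
    have : Algebra.lsmul k k (M i) r = S := (b i).ext h
    rw [← this]
    rfl
  refine ⟨r, hlin j T fun a => ?_, fun i hi => hlin i 0 fun a => ?_⟩
  · rw [← hr']
    simp [f]
  · rw [← hr']
    simp [f, Pi.single_eq_of_ne hi]

end Density

variable {k G ι : Type*} [Field k] [IsAlgClosed k] [Group G] {V : ι → Type*}
  [∀ i, AddCommGroup (V i)] [∀ i, Module k (V i)] [∀ i, FiniteDimensional k (V i)]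

theorem exists_asAlgebraHom_eq [Finite ι] (X : ∀ i, Representation k G (V i))
    (hirr : ∀ i, (X i).IsIrreducible) (hne : ∀ i j, i ≠ j → IsEmpty ((X i).Equiv (X j)))
    (j : ι) (T : Module.End k (V j)) :
    ∃ r : MonoidAlgebra k G, (X j).asAlgebraHom r = T ∧ ∀ i, i ≠ j → (X i).asAlgebraHom r = 0 := by
  obtain ⟨r, h1, h2⟩ := exists_smul_eq_end (k := k) (A := MonoidAlgebra k G)
    (M := fun i => (X i).asModule) (fun i j hij => ⟨fun e => (hne i j hij).false
      (((IntertwiningMap.equivLinearMapAsModule (X i) (X j)).symm e.toLinearMap).ofBijective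
        e.bijective)⟩) j T
  exact ⟨r, LinearMap.ext h1, fun i hi => LinearMap.ext (h2 i hi)⟩

/-- Extend a relation linearly to the group algebra and evaluate it at an element acting with trace
1 on `V j` and as 0 on the other spaces. An operator of trace 1 is needed because dim `V j` may
vanish in k. -/
theorem linearIndependent_character (X : ∀ i, Representation k G (V i))
    (hirr : ∀ i, (X i).IsIrreducible) (hne : ∀ i j, i ≠ j → IsEmpty ((X i).Equiv (X j))) :
    LinearIndependent k (fun i => (X i).character) := by
  classical
  refine linearIndependent_iff'.2 fun s c hc j hj => ?_
  have hlin : ∀ r : MonoidAlgebra k G,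
      ∑ i ∈ s, c i * LinearMap.trace k (V i) ((X i).asAlgebraHom r) = 0 := by
    intro r
    induction r using MonoidAlgebra.induction_linear with
    | zero => simp
    | add x y hx hy => simp [mul_add, Finset.sum_add_distrib, hx, hy]
    | single g a =>
      have := congrArg (a * ·) (congrFun hc g)
      simp only [Finset.sum_apply, Pi.smul_apply, smul_eq_mul, Finset.mul_sum, Pi.zero_apply,
        mul_zero] at this
      rw [← this]
      refine Finset.sum_congr rfl fun i _ => ?_
      simp only [asAlgebraHom_single, map_smul, smul_eq_mul, character]
      ring
  have hnt : Nontrivial (V j) := by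
    have := hirr j
    exact IsSimpleModule.nontrivial (MonoidAlgebra k G) (X j).asModule
  obtain ⟨T, hT⟩ := exists_end_trace_eq_one k (V j)
  obtain ⟨r, hr, hr0⟩ := exists_asAlgebraHom_eq (fun i : s => X i) (fun i => hirr i)
    (fun i l h => hne i l fun h' => h (Subtype.ext h')) ⟨j, hj⟩ T
  have := hlin r
  rw [Finset.sum_eq_single j] at this
  · simpa [hr, hT] using this
  · intro i hi hij
    rw [hr0 ⟨i, hi⟩ fun h => hij (congrArg Subtype.val h)]
    simp
  · exact fun h => absurd hj h

end TraceIndependence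

/-! ### The residue field F and a valuation ring above I -/

section Reduction

variable (I : Ideal AlgInt) [I.IsMaximal]

/-- A monic polynomial over F lifts to a monic one over R. Its complex root is integral over R,
hence lies in R, and reduces to a root. -/
instance isAlgClosed_residueField : IsAlgClosed (AlgInt ⧸ I) := by
  refine IsAlgClosed.of_exists_root _ fun q hq hirr => ?_
  obtain ⟨Q, hQ, -, hQm⟩ := Polynomial.lifts_and_natDegree_eq_and_monic
    (f := Ideal.Quotient.mk I) (p := q)
    ((Polynomial.mem_lifts _).2 (Polynomial.map_surjective _ Ideal.Quotient.mk_surjective q)) hq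
  have hdeg : Q.degree ≠ 0 := by
    intro h
    have : Q = 1 := Polynomial.Monic.degree_le_zero_iff_eq_one hQm |>.1 h.le
    rw [this, Polynomial.map_one] at hQ
    exact hirr.not_isUnit (hQ ▸ isUnit_one)
  obtain ⟨z, hz⟩ := IsAlgClosed.exists_aeval_eq_zero ℂ Q (by
    exact hdeg)
  have hzint : IsIntegral ℤ z := isIntegral_trans (A := AlgInt) z ⟨Q, hQm, hz⟩
  refine ⟨Ideal.Quotient.mk I ⟨z, hzint⟩, ?_⟩
  rw [← hQ, Polynomial.eval_map, Polynomial.eval₂_at_apply]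
  have : Q.eval ⟨z, hzint⟩ = 0 := by
    have h2 : algebraMap AlgInt ℂ (Q.eval ⟨z, hzint⟩) = 0 := by
      rw [← Polynomial.aeval_algebraMap_apply_eq_algebraMap_eval]
      exact hz
    exact Subtype.ext h2
  rw [this, map_zero]

/-- The inclusion of the ring of algebraic integers into the field of algebraic numbers. -/
def algIntToAlgNum : AlgInt →+* AlgNum :=
  (algebraMap AlgInt ℂ).codRestrict (algebraicClosure ℚ ℂ).toSubring fun x =>
    mem_algebraicClosure_iff.2
      ((IsIntegral.isAlgebraic (R := ℤ) x.2).extendScalars Rat.intCast_injective)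

@[simp]
theorem coe_algIntToAlgNum (x : AlgInt) : (algIntToAlgNum x : ℂ) = x := rfl

theorem algIntToAlgNum_injective : Function.Injective algIntToAlgNum := fun _ _ h =>
  Subtype.ext (congrArg (Subtype.val : AlgNum → ℂ) h)

variable {I} in
theorem charP_residueField {p : ℕ} (hp : p.Prime) (hI : (p : AlgInt) ∈ I) :
    CharP (AlgInt ⧸ I) p :=
  (CharP.charP_iff_prime_eq_zero hp).2 (by
    rw [← map_natCast (Ideal.Quotient.mk I), Ideal.Quotient.eq_zero_iff_mem]
    exact hI)

variable {I} in
theorem exists_valuationSubring {p : ℕ} (hp : p.Prime) (hI : (p : AlgInt) ∈ I) :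
    ∃ (V : ValuationSubring AlgNum) (π : V →+* AlgInt ⧸ I) (ι : AlgInt →+* V),
      (∀ x, (ι x : AlgNum) = algIntToAlgNum x) ∧ ∀ x, π (ι x) = Ideal.Quotient.mk I x := by
  let e := RingHom.rangeRestrict algIntToAlgNum
  have he : Function.Injective e := fun x y h => algIntToAlgNum_injective (congrArg Subtype.val h)
  have hemax : I.map e ≠ ⊤ := by
    intro h
    have := Ideal.comap_map_of_bijective e ⟨he, algIntToAlgNum.rangeRestrict_surjective⟩ (I := I)
    rw [h, Ideal.comap_top] at this
    exact Ideal.IsMaximal.ne_top inferInstance this.symm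
  obtain ⟨V, hV, hVI⟩ := Ideal.image_subset_nonunits_valuationSubring (I.map e) hemax
  let ι : AlgInt →+* V := algIntToAlgNum.codRestrict V.toSubring fun x => hV ⟨x, rfl⟩
  have hker : ∀ x ∈ I, IsLocalRing.residue V (ι x) = 0 := by
    intro x hx
    rw [IsLocalRing.residue_eq_zero_iff]
    obtain ⟨_, h⟩ := ValuationSubring.mem_nonunits_iff_exists_mem_maximalIdeal.1
      (hVI ⟨e x, Ideal.mem_map_of_mem e hx, rfl⟩)
    exact h
  let r : AlgInt ⧸ I →+* IsLocalRing.ResidueField V :=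
    Ideal.Quotient.lift I ((IsLocalRing.residue V).comp ι) hker
  let _ : Algebra (AlgInt ⧸ I) (IsLocalRing.ResidueField V) := r.toAlgebra
  -- Each element of V is a root of a primitive integer polynomial, which stays nonzero modulo p. So
  -- the residue field is algebraic over the algebraically closed F, hence equal to it.
  have halg : Algebra.IsIntegral (AlgInt ⧸ I) (IsLocalRing.ResidueField V) := by
    refine ⟨fun y => ?_⟩
    obtain ⟨v, rfl⟩ := IsLocalRing.residue_surjective y
    obtain ⟨q, hq0, hq⟩ : IsAlgebraic ℤ (v : AlgNum) :=
      (IsFractionRing.isAlgebraic_iff ℤ ℚ AlgNum).2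
        ((algebraicClosure.isAlgebraic ℚ ℂ).isAlgebraic (v : AlgNum))
    have hq' := Polynomial.aeval_primPart_eq_zero hq0 hq
    have hv : Polynomial.aeval v q.primPart = 0 := by
      refine Subtype.ext (Eq.trans ?_ hq')
      exact Polynomial.hom_eval₂ _ _ V.subtype _ |>.trans (by congr 1)
    refine IsAlgebraic.isIntegral ⟨q.primPart.map (Int.castRingHom _), fun h => ?_, ?_⟩
    · have := charP_residueField hp hI
      have hdvd : Polynomial.C (p : ℤ) ∣ q.primPart := by
        refine (Polynomial.C_dvd_iff_dvd_coeff _ _).2 fun i => ?_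
        rw [← CharP.intCast_eq_zero_iff (AlgInt ⧸ I) p]
        simpa using congrArg (fun f => f.coeff i) h
      exact (Nat.prime_iff_prime_int.1 hp).not_isUnit (q.isPrimitive_primPart _ hdvd)
    · have := congrArg (IsLocalRing.residue V) hv
      rw [map_zero, Polynomial.aeval_def, Polynomial.hom_eval₂] at this
      rw [← this, Polynomial.aeval_def, Polynomial.eval₂_map]
      congr 1
  let E := RingEquiv.ofBijective (algebraMap (AlgInt ⧸ I) (IsLocalRing.ResidueField V))
    IsAlgClosed.algebraMap_bijective_of_isIntegral
  refine ⟨V, E.symm.toRingHom.comp (IsLocalRing.residue V), ι, fun x => rfl, fun x => ?_⟩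
  change E.symm _ = _
  rw [RingEquiv.symm_apply_eq]
  rfl

end Reduction

/-! ### Lifting roots of unity of order prime to p -/

section RootLift

variable (G : Type*) [Group G] [Fintype G] {p : ℕ} {I : Ideal AlgInt} [I.IsMaximal]

/-- If u = z/w ≠ 1, then 1 + u + ⋯ + u^(m-1) = 0; as u reduces to 1, this gives m = 0 in F,
contradicting p ∤ m. -/
theorem eq_of_pow_eq_one_of_mk_eq (hp : p.Prime) (hI : (p : AlgInt) ∈ I) {m : ℕ} (hm : ¬ p ∣ m)
    {z w : AlgInt} (hz : z ^ m = 1) (hw : w ^ m = 1)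
    (h : Ideal.Quotient.mk I z = Ideal.Quotient.mk I w) : z = w := by
  have := charP_residueField hp hI
  have hm0 : m ≠ 0 := fun h => hm (h ▸ dvd_zero p)
  set u := z * w ^ (m - 1) with hu
  have hmk : Ideal.Quotient.mk I u = 1 := by
    rw [hu, map_mul, h, ← map_mul, mul_pow_sub_one hm0, hw, map_one]
  have hum : u ^ m = 1 := by
    rw [hu, mul_pow, hz, ← pow_mul, mul_comm (m - 1), pow_mul, hw, one_pow, one_mul]
  have hu1 : u = 1 := by
    by_contra hne
    have h0 : ∑ i ∈ Finset.range m, u ^ i = 0 := by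
      have := mul_geom_sum u m
      rw [hum, sub_self] at this
      exact (mul_eq_zero.1 this).resolve_left (sub_ne_zero.2 hne)
    have h1 := congrArg (Ideal.Quotient.mk I) h0
    simp only [map_sum, map_pow, hmk, one_pow, Finset.sum_const, Finset.card_range, nsmul_eq_mul,
      mul_one, map_zero] at h1
    exact hm ((CharP.cast_eq_zero_iff (AlgInt ⧸ I) p m).1 h1)
  calc z = z * w ^ m := by rw [hw, mul_one]
    _ = u * w := by rw [hu, mul_assoc, pow_sub_one_mul hm0]
    _ = w := by rw [hu1, one_mul]

theorem not_dvd_ordCompl_card (hp : p.Prime) : ¬ p ∣ ordCompl[p] (Nat.card G) :=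
  Nat.not_dvd_ordCompl hp Nat.card_pos.ne'

variable {G}

theorem rootLift_mk (hp : p.Prime) (hI : (p : AlgInt) ∈ I) {z : AlgInt}
    (hz : z ^ (ordCompl[p] (Nat.card G)) = 1) :
    rootLift G p I (Ideal.Quotient.mk I z) = z := by
  have h := Classical.epsilon_spec (p := fun w : AlgInt =>
    w ^ (ordCompl[p] (Nat.card G)) = 1 ∧ Ideal.Quotient.mk I w = Ideal.Quotient.mk I z)
    ⟨z, hz, rfl⟩
  exact eq_of_pow_eq_one_of_mk_eq hp hI (not_dvd_ordCompl_card G hp) h.1 hz h.2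

theorem exists_pow_eq_one_of_mk (hp : p.Prime) (hI : (p : AlgInt) ∈ I) {m : ℕ} (hm : ¬ p ∣ m)
    {ζ : AlgInt ⧸ I} (hζ : ζ ^ m = 1) :
    ∃ z : AlgInt, z ^ m = 1 ∧ Ideal.Quotient.mk I z = ζ := by
  have hm0 : m ≠ 0 := fun h => hm (h ▸ dvd_zero p)
  have : NeZero m := ⟨hm0⟩
  have hω := Complex.isPrimitiveRoot_exp m hm0
  set ω' := Complex.exp (2 * Real.pi * Complex.I / m)
  let ω : AlgInt := ⟨ω', hω.isIntegral (Nat.pos_of_ne_zero hm0)⟩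
  have hω1 : ω ^ m = 1 := Subtype.ext hω.pow_eq_one
  have hprim : IsPrimitiveRoot (Ideal.Quotient.mk I ω) m := by
    refine ⟨by rw [← map_pow, hω1, map_one], fun l hl => hω.dvd_of_pow_eq_one l ?_⟩
    have := eq_of_pow_eq_one_of_mk_eq hp hI hm (z := ω ^ l) (w := 1)
      (by rw [← pow_mul, mul_comm, pow_mul, hω1, one_pow]) (one_pow _)
      (by rw [map_pow, hl, map_one])
    exact congrArg Subtype.val this
  obtain ⟨i, -, hi⟩ := hprim.eq_pow_of_pow_eq_one hζ
  exact ⟨ω ^ i, by rw [← pow_mul, mul_comm, pow_mul, hω1, one_pow], by rw [map_pow, hi]⟩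

theorem mk_rootLift (hp : p.Prime) (hI : (p : AlgInt) ∈ I) {ζ : AlgInt ⧸ I}
    (hζ : ζ ^ (ordCompl[p] (Nat.card G)) = 1) :
    Ideal.Quotient.mk I (rootLift G p I ζ) = ζ := by
  obtain ⟨z, hz, rfl⟩ := exists_pow_eq_one_of_mk hp hI (not_dvd_ordCompl_card G hp) hζ
  rw [rootLift_mk hp hI hz]

end RootLift

/-! ### The p-regular part of an element -/

section PRegularPart

open Representation

variable {G : Type*} [Group G] [Finite G] {p : ℕ}

theorem exists_isPRegular_pow_eq (hp : p.Prime) (g : G) :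
    ∃ h : G, IsPRegular p h ∧ Commute g h ∧ ∃ a : ℕ, h ^ p ^ a = g ^ p ^ a := by
  set n := orderOf g with hn
  have hn0 : n ≠ 0 := (orderOf_pos g).ne'
  set a := n.factorization p
  set m := n / p ^ a
  have hm : ¬ p ∣ m := Nat.not_dvd_ordCompl hp hn0
  have hmul : p ^ a * m = n := Nat.ordProj_mul_ordCompl_eq_self n p
  have hco : Nat.Coprime (p ^ a) m :=
    Nat.Coprime.pow_left _ ((Nat.Prime.coprime_iff_not_dvd hp).2 hm)
  -- With k ≡ 0 mod p^a and k ≡ 1 mod m, the power g^k is the p-regular part of g.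
  obtain ⟨k, hk0, hk1⟩ := Nat.chineseRemainder hco 0 1
  refine ⟨g ^ k, fun hdvd => hm (hdvd.trans (orderOf_dvd_of_pow_eq_one ?_)),
    Commute.pow_right rfl k, a, ?_⟩
  · rw [← pow_mul, ← orderOf_dvd_iff_pow_eq_one, ← hn, ← hmul]
    exact Nat.mul_dvd_mul_right ((Nat.modEq_zero_iff_dvd).1 hk0) m
  · rw [← pow_mul, pow_eq_pow_iff_modEq, ← hn, ← hmul, mul_comm (p ^ a) m]
    simpa using hk1.mul_right' (p ^ a)

/-- In characteristic `p`, characters only depend on the `p`-regular part of an element. -/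
theorem exists_isPRegular_character_eq {k : Type*} [Field k] [CharP k p] (hp : p.Prime) (g : G) :
    ∃ h : G, IsPRegular p h ∧ ∀ (n : ℕ) (X : Representation k G (Fin n → k)),
      X.character g = X.character h := by
  have : Fact p.Prime := ⟨hp⟩
  obtain ⟨h, hreg, hcomm, a, ha⟩ := exists_isPRegular_pow_eq hp g
  refine ⟨h, hreg, fun n X => ?_⟩
  have : CharP (MonoidAlgebra k G) p :=
    charP_of_injective_algebraMap (algebraMap k (MonoidAlgebra k G)).injective p
  -- Frobenius: g and h commute, so (g - h)^(p^a) = g^(p^a) - h^(p^a) = 0. Nilpotent operators have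
  -- trace 0.
  have hnil : IsNilpotent (MonoidAlgebra.of k G g - MonoidAlgebra.of k G h) := by
    refine ⟨p ^ a, ?_⟩
    rw [sub_pow_char_pow_of_commute _ _ (hcomm.map (MonoidAlgebra.of k G)), ← map_pow, ← map_pow,
      ha, sub_self]
  have h1 := (LinearMap.isNilpotent_trace_of_isNilpotent (hnil.map X.asAlgebraHom)).eq_zero
  rw [map_sub, map_sub, asAlgebraHom_of, asAlgebraHom_of, sub_eq_zero] at h1
  exact h1

end PRegularPart

/-! ### Linear independence of `IBr` -/

section BrauerCharacters

open Representation

variable {G : Type*} [Group G] {p : ℕ} {I : Ideal AlgInt} [I.IsMaximal]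

theorem IsPRegular.pow_ordCompl_eq_one (hp : p.Prime) {g : G} (hg : IsPRegular p g) :
    g ^ (ordCompl[p] (Nat.card G)) = 1 := by
  refine orderOf_dvd_iff_pow_eq_one.1 ?_
  refine Nat.Coprime.dvd_of_dvd_mul_left (m := ordProj[p] (Nat.card G)) ?_ ?_
  · exact Nat.Coprime.pow_right _ ((Nat.Prime.coprime_iff_not_dvd hp).2 hg).symm
  · rw [Nat.ordProj_mul_ordCompl_eq_self]
    exact orderOf_dvd_natCard g

theorem pow_eq_one_of_mem_roots_charpoly {k V : Type*} [Field k] [AddCommGroup V] [Module k V]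
    [FiniteDimensional k V] {f : Module.End k V} {m : ℕ} (hf : f ^ m = 1) {ζ : k}
    (hζ : ζ ∈ f.charpoly.roots) : ζ ^ m = 1 := by
  have hev : f.HasEigenvalue ζ := by
    rw [Module.End.hasEigenvalue_iff_isRoot_charpoly]
    exact (Polynomial.mem_roots'.1 hζ).2
  obtain ⟨v, hv⟩ := hev.exists_hasEigenvector
  have h1 := hv.pow_apply m
  rw [hf, Module.End.one_apply] at h1
  have h : (ζ ^ m - 1) • v = 0 := by rw [sub_smul, ← h1, one_smul, sub_self]
  exact sub_eq_zero.1 ((smul_eq_zero.1 h).resolve_right hv.2)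

theorem brauerCharacter_eq_of_equiv {m n : ℕ}
    {X : Representation (AlgInt ⧸ I) G (Fin m → AlgInt ⧸ I)}
    {Y : Representation (AlgInt ⧸ I) G (Fin n → AlgInt ⧸ I)} (e : X.Equiv Y) :
    brauerCharacter p I X = brauerCharacter p I Y := by
  funext g
  have : (X g).charpoly = (Y g).charpoly := by
    rw [← e.conj_apply_self, LinearEquiv.charpoly_conj]
  simp [brauerCharacter, this]

theorem isEmpty_equiv_of_brauerCharacter_ne {m n : ℕ}
    {X : Representation (AlgInt ⧸ I) G (Fin m → AlgInt ⧸ I)}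
    {Y : Representation (AlgInt ⧸ I) G (Fin n → AlgInt ⧸ I)}
    (h : brauerCharacter p I X ≠ brauerCharacter p I Y) : IsEmpty (X.Equiv Y) :=
  ⟨fun e => h (brauerCharacter_eq_of_equiv e)⟩

variable [Fintype G]

theorem exists_algInt_eq_brauerCharacter (hp : p.Prime) (hI : (p : AlgInt) ∈ I) {n : ℕ}
    (X : Representation (AlgInt ⧸ I) G (Fin n → AlgInt ⧸ I)) (g : G) :
    ∃ r : AlgInt, (r : ℂ) = brauerCharacter p I X g ∧
      (IsPRegular p g → Ideal.Quotient.mk I r = X.character g) := by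
  by_cases hg : IsPRegular p g
  · refine ⟨((X g).charpoly.roots.map (rootLift G p I)).sum, ?_, fun _ => ?_⟩
    · rw [brauerCharacter, if_pos hg]
      refine (map_multiset_sum (algebraMap AlgInt ℂ) _).trans ?_
      rw [Multiset.map_map]
      rfl
    · rw [map_multiset_sum, Multiset.map_map, character,
        Module.End.trace_eq_sum_roots_charpoly_of_splits (IsAlgClosed.splits _)]
      congr 1
      refine (Multiset.map_congr rfl fun ζ hζ => ?_).trans (Multiset.map_id _)
      refine mk_rootLift hp hI (pow_eq_one_of_mem_roots_charpoly ?_ hζ)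
      rw [← map_pow, hg.pow_ordCompl_eq_one hp, map_one]
  · exact ⟨0, by simp [brauerCharacter, hg], fun h => absurd h hg⟩

theorem eq_zero_of_sum_ibr_eq_zero (hp : p.Prime) (hI : (p : AlgInt) ∈ I) (s : Finset (IBr G p I))
    (c : IBr G p I → AlgNum) (hc : ∑ φ ∈ s, (c φ : ℂ) • (φ : G → ℂ) = 0) : ∀ φ ∈ s, c φ = 0 := by
  have := charP_residueField hp hI
  choose n X hirr hX using fun φ : IBr G p I => φ.2
  have hli := linearIndependent_character X hirr fun φ ψ h =>
    isEmpty_equiv_of_brauerCharacter_ne (p := p) fun h' => h (Subtype.ext (by rw [hX, hX, h']))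
  choose r hr hrmk using fun (φ : IBr G p I) (g : G) =>
    exists_algInt_eq_brauerCharacter hp hI (X φ) g
  obtain ⟨V, π, ι, hι, hπ⟩ := exists_valuationSubring hp hI
  by_contra! hne
  obtain ⟨φ₁, hφ₁, hc₁⟩ := hne
  -- Dividing by a coefficient of largest valuation puts all coefficients in V and makes one equal
  -- to 1, so the reduced relation is nontrivial.
  obtain ⟨φ₀, hφ₀, hmax⟩ := s.exists_max_image (fun φ => V.valuation (c φ)) ⟨φ₁, hφ₁⟩
  have hc₀ : c φ₀ ≠ 0 := by
    intro h
    have := hmax φ₁ hφ₁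
    rw [h, map_zero, le_zero_iff, map_eq_zero] at this
    exact hc₁ this
  have hd : ∀ φ : s, c φ / c φ₀ ∈ V := fun φ => by
    rw [← ValuationSubring.valuation_le_one_iff, map_div₀]
    exact div_le_one_of_le₀ (hmax φ φ.2) zero_le
  have hrel : ∀ g, ∑ φ : s, (⟨c φ / c φ₀, hd φ⟩ : V) * ι (r φ g) = 0 := by
    intro g
    apply Subtype.ext
    apply Subtype.ext
    have h1 := congrArg ((c φ₀ : ℂ)⁻¹ * ·) (congrFun hc g)
    rw [← Finset.sum_coe_sort] at h1
    simp only [Finset.sum_apply, Pi.smul_apply, smul_eq_mul, Finset.mul_sum, Pi.zero_apply,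
      mul_zero] at h1
    push_cast
    refine Eq.trans (Finset.sum_congr rfl fun φ _ => ?_) h1
    rw [hι, coe_algIntToAlgNum, hr, ← hX]
    ring
  have hrelF : ∑ φ : s, π ⟨c φ / c φ₀, hd φ⟩ • (X φ).character = 0 := by
    funext g
    -- Brauer characters reduce to traces only at p-regular elements; F-characters take the same
    -- value at g and its p-regular part.
    obtain ⟨h, hreg, hgh⟩ := exists_isPRegular_character_eq (k := AlgInt ⧸ I) hp g
    have h1 := congrArg π (hrel h)
    simp only [map_sum, map_mul, hπ, map_zero] at h1
    simp only [Finset.sum_apply, Pi.smul_apply, smul_eq_mul, Pi.zero_apply, hgh]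
    rw [← h1]
    exact Finset.sum_congr rfl fun φ _ => by rw [hrmk φ h hreg]
  have h2 := Fintype.linearIndependent_iff.1 (hli.comp (Subtype.val : s → IBr G p I)
    Subtype.val_injective) _ hrelF ⟨φ₀, hφ₀⟩
  have h3 : (⟨c φ₀ / c φ₀, hd ⟨φ₀, hφ₀⟩⟩ : V) = 1 := Subtype.ext (div_self hc₀)
  rw [h3, map_one] at h2
  exact one_ne_zero h2

theorem linearIndependent_ibr (hp : p.Prime) (hI : (p : AlgInt) ∈ I) :
    LinearIndependent ℂ (Subtype.val : IBr G p I → G → ℂ) := by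
  refine linearIndependent_iff'.2 fun s c hc φ hφ => ?_
  -- Brauer characters have values in R, so a K-linear functional on ℂ turns a complex relation into
  -- one over K.
  rw [← Module.forall_dual_apply_eq_zero_iff AlgNum]
  intro l
  refine eq_zero_of_sum_ibr_eq_zero hp hI s (fun φ => l (c φ)) ?_ φ hφ
  funext g
  have h1 := congrArg l (congrFun hc g)
  rw [Finset.sum_apply, map_sum, Pi.zero_apply, map_zero] at h1
  rw [Finset.sum_apply, Pi.zero_apply]
  have h2 := congrArg (Subtype.val : AlgNum → ℂ) h1
  push_cast at h2
  rw [← h2]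
  refine Finset.sum_congr rfl fun φ _ => ?_
  obtain ⟨_, n, X, hX, rfl⟩ := φ
  obtain ⟨r, hr, -⟩ := exists_algInt_eq_brauerCharacter hp hI X g
  simp only [Pi.smul_apply, smul_eq_mul, ← hr]
  set z := c _
  have : z * (r : ℂ) = algIntToAlgNum r • z := mul_comm _ _
  rw [this, map_smul, smul_eq_mul, mul_comm]
  rfl

theorem finite_ibr (hp : p.Prime) (hI : (p : AlgInt) ∈ I) : Finite (IBr G p I) :=
  (linearIndependent_ibr hp hI).finite

end BrauerCharacters

/-! ### Characteristic polynomials along an invariant submodule -/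

section CharpolyQuotient

variable {R V : Type*} [CommRing R] [AddCommGroup V] [Module R V] [Module.Finite R V]
  [Module.Free R V] (W : Submodule R V) [Module.Free R W] [Module.Finite R W]
  [Module.Free R (V ⧸ W)]

open Module.Basis in
theorem charpoly_eq_charpoly_restrict_mul_charpoly_mapQ (f : V →ₗ[R] V) (hf : W ≤ W.comap f) :
    f.charpoly = (f.restrict hf).charpoly * (W.mapQ W f hf).charpoly := by
  let bW := Module.Free.chooseBasis R W
  let bQ := Module.Free.chooseBasis R (V ⧸ W)
  let b := sumQuot bW bQ
  let A := LinearMap.toMatrix bW bW (f.restrict hf)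
  let B := Matrix.of fun i l => (b.repr (f (b (Sum.inr l)))) (Sum.inl i)
  let D := LinearMap.toMatrix bQ bQ (W.mapQ W f hf)
  suffices LinearMap.toMatrix b b f = Matrix.fromBlocks A B 0 D by
    rw [← LinearMap.charpoly_toMatrix f b, this, ← LinearMap.charpoly_toMatrix _ bW,
      ← LinearMap.charpoly_toMatrix _ bQ, Matrix.charpoly_fromBlocks_zero₂₁]
  ext u v
  cases u with
  | inl i =>
    cases v with
    | inl k =>
      simp only [b, sumQuot_inl, Matrix.fromBlocks_apply₁₁, A, LinearMap.toMatrix_apply]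
      apply sumQuot_repr_inl_of_mem
    | inr l => simp [LinearMap.toMatrix_apply, Matrix.fromBlocks_apply₁₂, B]
  | inr j =>
    cases v with
    | inl k =>
      have : W.mkQ (f (bW k)) = 0 := by
        rw [← LinearMap.mem_ker, Submodule.ker_mkQ]
        exact hf (bW k).2
      simp [LinearMap.toMatrix_apply, b, this]
    | inr l =>
      simp only [LinearMap.toMatrix_apply, sumQuot_repr_inr, b, D, Matrix.fromBlocks_apply₂₂,
        ← sumQuot_inr bW bQ, Submodule.mapQ_apply, Submodule.mkQ_apply]

end CharpolyQuotient

/-! ### Brauer characters as sums of irreducible ones -/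

section BrauerCharacterClosure

open Representation

variable {G : Type*} [Group G] {p : ℕ} {I : Ideal AlgInt} [I.IsMaximal]

open Classical in
/-- The Brauer character of a representation on an arbitrary vector space. -/
def brauerFunction (p : ℕ) {V : Type*} [AddCommGroup V] [Module (AlgInt ⧸ I) V]
    [FiniteDimensional (AlgInt ⧸ I) V] (ρ : Representation (AlgInt ⧸ I) G V) : G → ℂ :=
  fun g => if IsPRegular p g then
    ((ρ g).charpoly.roots.map fun ζ => (rootLift G p I ζ : ℂ)).sum else 0

/-- Induction on dimension: a proper nonzero subrepresentation factors each characteristic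
polynomial, so the multisets of eigenvalues, and hence the sums of lifts, add. -/
theorem brauerFunction_mem_closure (V : Type) [AddCommGroup V] [Module (AlgInt ⧸ I) V]
    [FiniteDimensional (AlgInt ⧸ I) V] (ρ : Representation (AlgInt ⧸ I) G V) :
    brauerFunction p ρ ∈ AddSubmonoid.closure (IBr G p I) := by
  induction hd : Module.finrank (AlgInt ⧸ I) V using Nat.strong_induction_on generalizing V with
  | _ d ih =>
  by_cases hirr : ρ.IsIrreducible
  · obtain ⟨Y, ⟨e⟩⟩ := exists_equiv_fin ρ
    refine AddSubmonoid.subset_closure ⟨_, Y, isIrreducible_of_equiv e hirr, ?_⟩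
    funext g
    have : (Y g).charpoly = (ρ g).charpoly := by
      rw [← e.conj_apply_self, LinearEquiv.charpoly_conj]
    simp [brauerFunction, brauerCharacter, this]
  rcases subsingleton_or_nontrivial V with hV | hV
  · convert AddSubmonoid.zero_mem _
    funext g
    have : (ρ g).charpoly = 1 :=
      (Polynomial.Monic.natDegree_eq_zero (LinearMap.charpoly_monic _)).1 (by
        rw [LinearMap.charpoly_natDegree, Module.finrank_zero_of_subsingleton])
    simp [brauerFunction, this]
  · obtain ⟨W, hbot, htop⟩ : ∃ W : Subrepresentation ρ, W ≠ ⊥ ∧ W ≠ ⊤ := by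
      by_contra! h
      have : Nontrivial (Subrepresentation ρ) := by
        refine ⟨⊥, ⊤, fun h' => ?_⟩
        have := congrArg Subrepresentation.toSubmodule h'
        exact bot_ne_top (α := Submodule (AlgInt ⧸ I) V) this
      exact hirr ⟨fun W => or_iff_not_imp_left.2 (h W)⟩
    have hle : ∀ g, W.toSubmodule ≤ W.toSubmodule.comap (ρ g) := W.apply_mem_toSubmodule
    have hsum : brauerFunction p ρ =
        brauerFunction p W.toRepresentation + brauerFunction p (ρ.quotient W.toSubmodule hle) := by
      funext g
      have h1 := charpoly_eq_charpoly_restrict_mul_charpoly_mapQ W.toSubmodule (ρ g) (hle g)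
      by_cases hg : IsPRegular p g
      · simp only [brauerFunction, if_pos hg, Pi.add_apply]
        rw [h1, Polynomial.roots_mul
          (mul_ne_zero (LinearMap.charpoly_monic _).ne_zero (LinearMap.charpoly_monic _).ne_zero),
          Multiset.map_add, Multiset.sum_add]
        rfl
      · simp [brauerFunction, hg]
    rw [hsum]
    refine add_mem (ih _ ?_ _ _ rfl) (ih _ ?_ _ _ rfl)
    · rw [← hd]
      exact Submodule.finrank_lt fun h => htop (Subrepresentation.toSubmodule_injective h)
    · rw [← hd]
      have h1 := W.toSubmodule.finrank_quotient_add_finrank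
      have h2 : 0 < Module.finrank (AlgInt ⧸ I) W.toSubmodule :=
        Submodule.one_le_finrank_iff.2 fun h => hbot (Subrepresentation.toSubmodule_injective h)
      omega

theorem brauerCharacter_mem_closure {n : ℕ}
    (X : Representation (AlgInt ⧸ I) G (Fin n → AlgInt ⧸ I)) :
    brauerCharacter p I X ∈ AddSubmonoid.closure (IBr G p I) :=
  brauerFunction_mem_closure _ X

end BrauerCharacterClosure

/-! ### Integral forms over a valuation ring -/

section Lattice

open Representation Polynomial

variable {K : Type*} [Field K] {G : Type*} [Group G]

/-- A representation over a valued field is defined over the valuation ring. -/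
theorem exists_integral_form [Finite G] (V : ValuationSubring K) {n : ℕ}
    (X : Representation K G (Fin n → K)) :
    ∃ (r : ℕ) (A : G →* Matrix (Fin r) (Fin r) V),
      ∀ g, (A g).charpoly.map (algebraMap V K) = (X g).charpoly := by
  -- The G-translates of the standard basis span a G-stable finitely generated lattice. It is
  -- torsion-free over a valuation ring, hence flat, hence free.
  let v : G × Fin n → Fin n → K := fun a => X a.1 (Pi.single a.2 1)
  let L : Submodule V (Fin n → K) := Submodule.span V (Set.range v)
  have hlat : Submodule.IsLattice K L :=
    { fg := Submodule.fg_span (Set.finite_range v)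
      span_eq_top := by
        rw [eq_top_iff, ← (Pi.basisFun K (Fin n)).span_eq]
        refine Submodule.span_mono ?_
        rintro _ ⟨i, rfl⟩
        refine Submodule.subset_span ⟨(1, i), ?_⟩
        simp [v] }
  have hflat : Module.Flat V L := by
    rw [Module.Flat.flat_iff_torsion_eq_bot_of_isBezout,
      ← Submodule.isTorsionFree_iff_torsion_eq_bot]
    infer_instance
  have hfree : Module.Free V L := Module.free_of_flat_of_isLocalRing
  have hstab : ∀ g, ∀ x ∈ L, X g x ∈ L := by
    intro g x hx
    refine (Submodule.map_span_le ((X g).restrictScalars V) _ L).2 ?_ (Submodule.mem_map_of_mem hx)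
    rintro _ ⟨⟨h, i⟩, rfl⟩
    refine Submodule.subset_span ⟨(g * h, i), ?_⟩
    simp [v]
  let ρ : G →* Module.End V L :=
    { toFun := fun g => ((X g).restrictScalars V).restrict (hstab g)
      map_one' := LinearMap.ext fun x => Subtype.ext (LinearMap.congr_fun (map_one X) x)
      map_mul' := fun g h => LinearMap.ext fun x =>
        Subtype.ext (LinearMap.congr_fun (map_mul X g h) x) }
  let b := Module.finBasis V L
  let B := b.extendOfIsLattice K
  refine ⟨_, (LinearMap.toMatrixAlgEquiv b).toMonoidHom.comp ρ, fun g => ?_⟩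
  have hrepr : ∀ x : L, ∀ i, B.repr x i = algebraMap V K (b.repr x i) := by
    intro x i
    have hx : (x : Fin n → K) = ∑ l, algebraMap V K (b.repr x l) • B l := by
      conv_lhs => rw [← b.sum_repr x, Submodule.coe_sum]
      refine Finset.sum_congr rfl fun l _ => ?_
      rw [algebraMap_smul, Module.Basis.extendOfIsLattice_apply]
      rfl
    rw [hx, B.repr_sum_self]
  rw [← Matrix.charpoly_map, ← LinearMap.charpoly_toMatrix (X g) B]
  congr 1
  ext i j
  rw [LinearMap.toMatrix_apply, Module.Basis.extendOfIsLattice_apply]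
  refine Eq.trans ?_ (hrepr (ρ g (b j)) i).symm
  exact congrArg (algebraMap V K) (LinearMap.toMatrix_apply b b (ρ g) i j)

end Lattice

/-! ### Reduction of ordinary characters -/

section Decomposition

open Representation Polynomial

theorem exists_multiset_charpoly_eq {f : Type*} [AddCommGroup f] [Module AlgNum f]
    [FiniteDimensional AlgNum f] (T : Module.End AlgNum f) {m : ℕ} (hm : m ≠ 0) (hT : T ^ m = 1) :
    ∃ Z : Multiset AlgInt, (∀ z ∈ Z, z ^ m = 1) ∧
      T.charpoly = ((Z.map fun z => X - C z).prod).map algIntToAlgNum := by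
  have h : ∀ μ ∈ T.charpoly.roots, ∃ z : AlgInt, z ^ m = 1 ∧ algIntToAlgNum z = μ := by
    intro μ hμ
    have h1 := pow_eq_one_of_mem_roots_charpoly hT hμ
    have h2 : (μ : ℂ) ^ m = 1 := congrArg (Subtype.val : AlgNum → ℂ) h1
    exact ⟨⟨μ, X ^ m - 1, monic_X_pow_sub_C 1 hm, by simp [h2]⟩, Subtype.ext h2, Subtype.ext rfl⟩
  choose! z hz1 hz2 using h
  refine ⟨T.charpoly.roots.map z, fun w hw => ?_, ?_⟩
  · obtain ⟨μ, hμ, rfl⟩ := Multiset.mem_map.1 hw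
    exact hz1 μ hμ
  · rw [Polynomial.map_multiset_prod, Multiset.map_map, Multiset.map_map]
    conv_lhs => rw [(IsAlgClosed.splits T.charpoly).eq_prod_roots_of_monic T.charpoly_monic]
    congr 1
    refine Multiset.map_congr rfl fun μ hμ => ?_
    simp [hz2 μ hμ]

variable {G : Type*} [Group G] [Fintype G] {p : ℕ} {I : Ideal AlgInt} [I.IsMaximal]

/-- At a p-regular element, the characteristic polynomials of `X` and of its reduction are images of
one product ∏ (X - z) over R, with z running over |G|_{p'}-th roots of unity. Lifting the reduced
eigenvalues recovers the z. -/
theorem exists_brauerCharacter_eq_pRegularRestriction (hp : p.Prime) (hI : (p : AlgInt) ∈ I) {n : ℕ}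
    (X : Representation AlgNum G (Fin n → AlgNum)) :
    ∃ (r : ℕ) (Y : Representation (AlgInt ⧸ I) G (Fin r → AlgInt ⧸ I)),
      pRegularRestriction p (fun g => (X.character g : ℂ)) = brauerCharacter p I Y := by
  obtain ⟨V, π, ι, hι, hπ⟩ := exists_valuationSubring hp hI
  obtain ⟨r, A, hA⟩ := exists_integral_form V X
  refine ⟨r, (Matrix.toLinAlgEquiv' (R := AlgInt ⧸ I) (n := Fin r)).toMonoidHom.comp
    ((π.mapMatrix (m := Fin r)).toMonoidHom.comp A), ?_⟩
  funext g
  by_cases hg : IsPRegular p g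
  · simp only [pRegularRestriction, brauerCharacter, if_pos hg]
    have hm0 : ordCompl[p] (Nat.card G) ≠ 0 := fun h => not_dvd_ordCompl_card G hp (h ▸ dvd_zero p)
    obtain ⟨Z, hZ, hXZ⟩ := exists_multiset_charpoly_eq (X g) hm0
      (by rw [← map_pow, hg.pow_ordCompl_eq_one hp, map_one])
    have hAZ : (A g).charpoly = ((Z.map fun z => Polynomial.X - C z).prod).map ι := by
      refine Polynomial.map_injective (algebraMap V AlgNum) Subtype.val_injective ?_
      rw [hA, hXZ, Polynomial.map_map]
      congr 1
      exact RingHom.ext fun z => (hι z).symm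
    have hYZ : (((Matrix.toLinAlgEquiv' (R := AlgInt ⧸ I) (n := Fin r)).toMonoidHom.comp
        ((π.mapMatrix (m := Fin r)).toMonoidHom.comp A)) g).charpoly =
        ((Z.map fun z => Polynomial.X - C z).prod).map (Ideal.Quotient.mk I) := by
      refine (Matrix.charpoly_toLin' (π.mapMatrix (A g))).trans ?_
      rw [RingHom.mapMatrix_apply, Matrix.charpoly_map, hAZ, Polynomial.map_map]
      congr 1
      exact RingHom.ext hπ
    have hroots : ∀ {F : Type} [Field F] (f : AlgInt →+* F),
        (((Z.map fun z => Polynomial.X - C z).prod).map f).roots = Z.map f := by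
      intro F _ f
      rw [Polynomial.map_multiset_prod, Multiset.map_map,
        ← Polynomial.roots_multiset_prod_X_sub_C (Z.map f), Multiset.map_map]
      simp
    rw [hYZ, hroots, character, Module.End.trace_eq_sum_roots_charpoly_of_splits
      (IsAlgClosed.splits _), hXZ, hroots, Multiset.map_map]
    refine (map_multiset_sum (algebraMap AlgNum ℂ) _).trans ?_
    rw [Multiset.map_map]
    congr 1
    refine Multiset.map_congr rfl fun z hz => ?_
    change _ = ((rootLift G p I (Ideal.Quotient.mk I z) : AlgInt) : ℂ)
    rw [rootLift_mk hp hI (hZ z hz)]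
    rfl
  · simp [pRegularRestriction, brauerCharacter, hg]

theorem pRegularRestriction_mem_closure (hp : p.Prime) (hI : (p : AlgInt) ∈ I) (χ : Irr G) :
    pRegularRestriction p (χ : G → ℂ) ∈ AddSubmonoid.closure (IBr G p I) := by
  obtain ⟨_, n, X, hX, hχ⟩ := χ
  obtain ⟨r, Y, hY⟩ := exists_brauerCharacter_eq_pRegularRestriction hp hI X
  obtain rfl := funext hχ
  change pRegularRestriction p (fun g => (X.character g : ℂ)) ∈ _
  rw [hY]
  exact brauerCharacter_mem_closure Y

end Decomposition

/-! ### Decomposition numbers and the duality -/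

section Decomposition

variable {G : Type*} [Group G] {p : ℕ} {I : Ideal AlgInt} [I.IsMaximal]

theorem exists_finsupp_of_mem_closure_ibr {θ : G → ℂ} (hθ : θ ∈ AddSubmonoid.closure (IBr G p I)) :
    ∃ d : IBr G p I →₀ ℕ, θ = d.sum fun φ m => m • (φ : G → ℂ) := by
  classical
  induction hθ using AddSubmonoid.closure_induction with
  | mem x hx => exact ⟨Finsupp.single ⟨x, hx⟩ 1, by simp⟩
  | zero => exact ⟨0, by simp⟩
  | add x y _ _ hx hy =>
    obtain ⟨d, rfl⟩ := hx
    obtain ⟨d', rfl⟩ := hy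
    exact ⟨d + d', (Finsupp.sum_add_index' (by simp) fun _ _ _ => add_smul _ _ _).symm⟩

theorem pRegularRestriction_ibr (φ : IBr G p I) :
    pRegularRestriction p (φ : G → ℂ) = φ := by
  obtain ⟨_, n, X, hX, rfl⟩ := φ
  funext g
  by_cases hg : IsPRegular p g <;> simp [pRegularRestriction, brauerCharacter, hg]

theorem charpoly_apply_conj {k V : Type*} [Field k] [AddCommGroup V] [Module k V]
    [FiniteDimensional k V] (ρ : Representation k G V) (g h : G) :
    (ρ (h * g * h⁻¹)).charpoly = (ρ g).charpoly := by
  let e : V ≃ₗ[k] V := LinearEquiv.ofLinearMap (ρ h) (ρ h⁻¹) (by ext; simp) (by ext; simp)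
  rw [← LinearEquiv.charpoly_conj e (ρ g)]
  congr 1
  ext
  simp [e, LinearEquiv.conj_apply]

theorem brauerCharacter_conj {n : ℕ} (X : Representation (AlgInt ⧸ I) G (Fin n → AlgInt ⧸ I))
    (g h : G) : brauerCharacter p I X (h * g * h⁻¹) = brauerCharacter p I X g := by
  have h1 : IsPRegular p (h * g * h⁻¹) ↔ IsPRegular p g := by
    rw [IsPRegular, IsPRegular, ← MulAut.conj_apply, MulEquiv.orderOf_eq]
  simp only [brauerCharacter, charpoly_apply_conj]
  by_cases hg : IsPRegular p g
  · rw [if_pos hg, if_pos (h1.2 hg)]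
  · rw [if_neg hg, if_neg fun h' => hg (h1.1 h')]

variable [Fintype G]

theorem pRegularRestriction_irr_eq_sum (hp : p.Prime) (hI : (p : AlgInt) ∈ I) [Fintype (IBr G p I)]
    (χ : Irr G) : pRegularRestriction p (χ : G → ℂ) =
      ∑ φ : IBr G p I, (decompositionNumber p I χ φ : ℂ) • (φ : G → ℂ) := by
  -- The row is an arbitrary choice by definition; it satisfies its equation because an expansion
  -- exists.
  have h := Classical.epsilon_spec (p := fun d : IBr G p I →₀ ℕ =>
    pRegularRestriction p (χ : G → ℂ) = d.sum fun φ m => m • (φ : G → ℂ))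
    (exists_finsupp_of_mem_closure_ibr (pRegularRestriction_mem_closure hp hI χ))
  refine h.trans ?_
  rw [Finsupp.sum_fintype _ _ (by simp)]
  exact Finset.sum_congr rfl fun φ _ => (Nat.cast_smul_eq_nsmul ℂ _ _).symm

-- Expand ψ in `Irr G`, restrict to p-regular elements, substitute the decomposition of each χ̂ and
-- compare coefficients of `IBr`.
open Classical in
theorem charInner_ibr_pim (hp : p.Prime) (hI : (p : AlgInt) ∈ I) (ψ φ : IBr G p I) :
    charInner (ψ : G → ℂ) (pim p I φ) = if ψ = φ then 1 else 0 := by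
  have := finite_ibr (G := G) hp hI
  have := Fintype.ofFinite (IBr G p I)
  have := Fintype.ofFinite (Irr G)
  have hpim : ∀ φ : IBr G p I, charInner (ψ : G → ℂ) (pim p I φ) =
      ∑ χ : Irr G, charInner (ψ : G → ℂ) (χ : G → ℂ) * decompositionNumber p I χ φ := by
    intro φ
    rw [pim, finsum_eq_sum_of_fintype, charInner_sum_right]
    refine Finset.sum_congr rfl fun χ _ => ?_
    rw [← Nat.cast_smul_eq_nsmul ℂ, charInner_smul_right, Complex.conj_natCast, mul_comm]
  have hclass : ∀ g h, (ψ : G → ℂ) (h * g * h⁻¹) = (ψ : G → ℂ) g := by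
    obtain ⟨_, n, X, hX, rfl⟩ := ψ
    exact brauerCharacter_conj X
  have hsum : (ψ : G → ℂ) = ∑ χ : Irr G, charInner (ψ : G → ℂ) (χ : G → ℂ) •
      pRegularRestriction p (χ : G → ℂ) := by
    funext g
    rw [← pRegularRestriction_ibr ψ]
    by_cases hg : IsPRegular p g
    · have := congrFun (classFunction_eq_sum_irr _ hclass) g
      simpa [pRegularRestriction, hg, pRegularRestriction_ibr] using this
    · simp [pRegularRestriction, hg]
  have hexp : ∑ φ : IBr G p I, (charInner (ψ : G → ℂ) (pim p I φ) - if ψ = φ then 1 else 0) •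
      (φ : G → ℂ) = 0 := by
    simp only [sub_smul, Finset.sum_sub_distrib, ite_smul, one_smul, zero_smul,
      Finset.sum_ite_eq, Finset.mem_univ, if_true, hpim, Finset.sum_smul]
    rw [sub_eq_zero, Finset.sum_comm]
    conv_rhs => rw [hsum]
    refine Finset.sum_congr rfl fun χ _ => ?_
    rw [pRegularRestriction_irr_eq_sum hp hI, Finset.smul_sum]
    exact Finset.sum_congr rfl fun φ _ => mul_smul _ _ _
  exact sub_eq_zero.1 (Fintype.linearIndependent_iff.1 (linearIndependent_ibr hp hI) _ hexp φ)

end Decomposition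

/-! ### ℤ-bases and unimodular matrices -/

section BasicSets

theorem isUnit_iff_linearIndependent_and_span_eq {E ι : Type*} [AddCommGroup E] [Fintype ι]
    [DecidableEq ι] {b : ι → E} (hb : LinearIndependent ℤ b) (A : Matrix ι ι ℤ) {v : ι → E}
    (hv : ∀ i, v i = ∑ j, A i j • b j) :
    IsUnit A ↔ LinearIndependent ℤ v ∧
      Submodule.span ℤ (Set.range v) = Submodule.span ℤ (Set.range b) := by
  have hcomb : ∀ c : ι → ℤ, ∑ i, c i • v i = ∑ j, (Matrix.vecMul c A) j • b j := by
    intro c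
    simp only [hv, Finset.smul_sum, Matrix.vecMul, dotProduct, Finset.sum_smul, smul_smul]
    exact Finset.sum_comm
  constructor
  · intro hA
    obtain ⟨C, hAC, hCA⟩ := isUnit_iff_exists.1 hA
    refine ⟨Fintype.linearIndependent_iff.2 fun c hc => ?_, le_antisymm ?_ ?_⟩
    · rw [hcomb] at hc
      have h0 : Matrix.vecMul c A = 0 := funext (Fintype.linearIndependent_iff.1 hb _ hc)
      have h1 : Matrix.vecMul (Matrix.vecMul c A) C = c := by
        rw [Matrix.vecMul_vecMul, hAC, Matrix.vecMul_one]
      rw [← h1, h0, Matrix.zero_vecMul]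
      exact fun _ => rfl
    · rw [Submodule.span_le]
      rintro _ ⟨i, rfl⟩
      rw [SetLike.mem_coe, hv]
      exact Submodule.sum_mem _ fun j _ =>
        Submodule.smul_mem _ _ (Submodule.subset_span ⟨j, rfl⟩)
    · rw [Submodule.span_le]
      rintro _ ⟨k, rfl⟩
      have : b k = ∑ i, C k i • v i := by
        have h1 : Matrix.vecMul (C k) A = (1 : Matrix ι ι ℤ) k := by
          rw [← hCA]
          rfl
        rw [hcomb, h1]
        simp [Matrix.one_apply, ite_smul]
      rw [SetLike.mem_coe, this]
      exact Submodule.sum_mem _ fun j _ =>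
        Submodule.smul_mem _ _ (Submodule.subset_span ⟨j, rfl⟩)
  -- Spanning alone suffices: writing b in terms of v gives C A = 1, and a one-sided inverse of a
  -- square matrix over ℤ is two-sided.
  · rintro ⟨-, hspan⟩
    have h : ∀ k, ∃ c : ι → ℤ, ∑ i, c i • v i = b k := fun k =>
      (Submodule.mem_span_range_iff_exists_fun ℤ).1 (hspan ▸ Submodule.subset_span ⟨k, rfl⟩)
    choose C hC using h
    refine IsUnit.of_mul_eq_one_right (Matrix.of C) ?_
    ext k l
    have h1 : ∑ j, (Matrix.vecMul (C k) A j - (1 : Matrix ι ι ℤ) k j) • b j = 0 := by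
      simp only [sub_smul, Finset.sum_sub_distrib, ← hcomb, hC]
      simp [Matrix.one_apply, ite_smul]
    exact sub_eq_zero.1 (Fintype.linearIndependent_iff.1 hb _ h1 l)

theorem isZBasis_iff_isUnit {G : Type*} {M : Submodule ℤ (G → ℂ)} {S : Set (G → ℂ)} {n : ℕ}
    (e : Fin n ≃ S)
    {b : Fin n → G → ℂ} (hb : LinearIndependent ℤ b)
    (hM : Submodule.span ℤ (Set.range b) = M) (A : Matrix (Fin n) (Fin n) ℤ)
    (hA : ∀ i, (e i : G → ℂ) = ∑ j, A i j • b j) : IsZBasis M S ↔ IsUnit A := by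
  have hrange : Set.range (fun i => (e i : G → ℂ)) = S := by
    rw [show (fun i => (e i : G → ℂ)) = Subtype.val ∘ e from rfl, EquivLike.range_comp,
      Subtype.range_coe]
  rw [isUnit_iff_linearIndependent_and_span_eq hb A hA, hrange, hM, IsZBasis,
    ← linearIndependent_equiv e]
  rfl

variable {G : Type*} [Group G] [Fintype G] {p : ℕ} {I : Ideal AlgInt} [I.IsMaximal]

/-- A common index set for IBr(B) and IPr(B) makes their pairing the identity matrix. -/
theorem exists_enumeration_ibrOf (hp : p.Prime) (hI : (p : AlgInt) ∈ I) (B : Set (Irr G)) :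
    ∃ φ : Fin (Nat.card (IBrOf p I B)) → IBr G p I, Function.Injective φ ∧
      Set.range (fun k => (φ k : G → ℂ)) = IBrOf p I B ∧
      Set.range (fun k => pim p I (φ k)) = IPrOf p I B := by
  have := finite_ibr (G := G) hp hI
  have hfin : Finite (IBrOf p I B) :=
    ((IBr G p I).toFinite.subset (by rintro _ ⟨φ, -, rfl⟩; exact φ.2)).to_subtype
  let ε := (Finite.equivFin (IBrOf p I B)).symm
  choose φ hφ hε using fun k => (ε k).2
  have hsurj : ∀ ψ : IBr G p I, InBlocks p I B ψ → ∃ k, φ k = ψ := fun ψ hψ => by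
    obtain ⟨k, hk⟩ := ε.surjective ⟨ψ, ψ, hψ, rfl⟩
    exact ⟨k, Subtype.ext (by rw [← hε, hk])⟩
  refine ⟨φ, fun k l h => ε.injective (Subtype.ext (by rw [hε, hε, h])), ?_, ?_⟩
  · ext θ
    constructor
    · rintro ⟨k, rfl⟩
      exact ⟨φ k, hφ k, rfl⟩
    · rintro ⟨ψ, hψ, rfl⟩
      obtain ⟨k, rfl⟩ := hsurj ψ hψ
      exact ⟨k, rfl⟩
  · ext θ
    constructor
    · rintro ⟨k, rfl⟩
      exact ⟨φ k, hφ k, rfl⟩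
    · rintro ⟨ψ, hψ, rfl⟩
      obtain ⟨k, rfl⟩ := hsurj ψ hψ
      exact ⟨k, rfl⟩

end BasicSets

end ModularCharacters
end

/-! ### The criterion for basic sets -/

open ModularCharacters in
theorem mainTheorem5 {G : Type*} [Group G] [Fintype G] (p : ℕ) (hp : p.Prime)
    (I : Ideal ModularCharacters.AlgInt) [I.IsMaximal] (hI : (p : ModularCharacters.AlgInt) ∈ I)
    (B : Set (ModularCharacters.Irr G)) (hB : ModularCharacters.IsUnionOfBlocks p I B)
    (BS PS : Set (G → ℂ))
    (hBS : BS ⊆ ModularCharacters.BrauerCharactersOf p I B)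
    (hPS : PS ⊆ ModularCharacters.ProjectiveCharactersOf p I B)
    (e : Fin (Nat.card (ModularCharacters.IBrOf p I B)) ≃ BS)
    (f : Fin (Nat.card (ModularCharacters.IBrOf p I B)) ≃ PS) :
    ∃ U : Matrix (Fin (Nat.card (ModularCharacters.IBrOf p I B)))
        (Fin (Nat.card (ModularCharacters.IBrOf p I B))) ℤ,
      U.map (Int.cast : ℤ → ℂ) = ModularCharacters.innerMatrix e f ∧
      ((ModularCharacters.IsBasicSetOfBrauerCharacters p I B BS ∧
          ModularCharacters.IsBasicSetOfProjectiveCharacters p I B PS) ↔ IsUnit U) := by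
  obtain ⟨φ, hφ, hβ, hγ⟩ := exists_enumeration_ibrOf hp hI B
  have hpair : ∀ i j, charInner (φ i : G → ℂ) (pim p I (φ j)) = if i = j then 1 else 0 := by
    intro i j
    rw [charInner_ibr_pim hp hI]
    by_cases h : i = j
    · rw [if_pos (congrArg φ h), if_pos h]
    · rw [if_neg (hφ.ne h), if_neg h]
  have hsum : ∀ c d : Fin (Nat.card (IBrOf p I B)) → ℤ,
      charInner (∑ k, c k • (φ k : G → ℂ)) (∑ l, d l • pim p I (φ l)) =
        ((∑ k, c k * d k : ℤ) : ℂ) := by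
    intro c d
    simp only [← Int.cast_smul_eq_zsmul ℂ, charInner_sum_left, charInner_smul_left,
      charInner_sum_right, charInner_smul_right, hpair, mul_ite, mul_one, mul_zero,
      Finset.sum_ite_eq', Finset.mem_univ, if_true, map_intCast]
    push_cast
    exact Finset.sum_congr rfl fun k _ => mul_comm _ _
  have hliβ : LinearIndependent ℤ (fun k => (φ k : G → ℂ)) :=
    ((linearIndependent_ibr hp hI).comp φ hφ).restrict_scalars fun a b h => by
      simpa using h
  -- Pairing a relation with `φ i` extracts its i-th coefficient.
  have hliγ : LinearIndependent ℤ (fun k => pim p I (φ k)) := by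
    refine Fintype.linearIndependent_iff.2 fun d hd i => ?_
    have h1 := hsum (Pi.single i 1) d
    have h2 : ∑ k, (Pi.single i 1 : _ → ℤ) k * d k = d i := by
      rw [Fintype.sum_eq_single i fun k hk => by rw [Pi.single_eq_of_ne hk, zero_mul],
        Pi.single_eq_same, one_mul]
    rw [hd, h2] at h1
    simpa [charInner] using h1.symm
  have hA : ∀ i, ∃ c : Fin (Nat.card (IBrOf p I B)) → ℤ,
      ∑ k, c k • (φ k : G → ℂ) = (e i : G → ℂ) := fun i => by
    rw [← Submodule.mem_span_range_iff_exists_fun, hβ]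
    exact (hBS (e i).2).2
  have hP : ∀ i, ∃ c : Fin (Nat.card (IBrOf p I B)) → ℤ,
      ∑ k, c k • pim p I (φ k) = (f i : G → ℂ) := fun i => by
    rw [← Submodule.mem_span_range_iff_exists_fun, hγ]
    exact (hPS (f i).2).2
  choose A hA using hA
  choose P hP using hP
  -- The dual bases pair to the identity, so only the two coordinate matrices remain in U.
  refine ⟨Matrix.of A * (Matrix.of P).transpose, ?_, ?_⟩
  · ext i j
    simp only [innerMatrix, Matrix.map_apply, Matrix.of_apply, ← hA, ← hP, hsum, Matrix.mul_apply,
      Matrix.transpose_apply]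
  · have h1 := isZBasis_iff_isUnit e hliβ (M := brauerGroupOf p I B) (by rw [hβ]; rfl)
      (Matrix.of A) fun i => (hA i).symm
    have h2 := isZBasis_iff_isUnit f hliγ (M := projectiveGroupOf p I B) (by rw [hγ]; rfl)
      (Matrix.of P) fun i => (hP i).symm
    rw [IsBasicSetOfBrauerCharacters, IsBasicSetOfProjectiveCharacters, h1, h2,
      Matrix.isUnit_iff_isUnit_det, Matrix.isUnit_iff_isUnit_det, Matrix.isUnit_iff_isUnit_det,
      Matrix.det_mul, Matrix.det_transpose, IsUnit.mul_iff]
    exact ⟨fun h => ⟨h.1.2, h.2.2⟩, fun h => ⟨⟨hBS, h.1⟩, ⟨hPS, h.2⟩⟩⟩
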